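/- Let $k$ be an algebraically closed field of characteristic $p\ge 0$, let $X$ be an irreducible smooth proper curve over $k$ with function field $k(X)$, and let $\infty\in X(k)$. Points of $X$ are closed points; $v_\xi$ is the normalized valuation of $k(X)$ at the point $\xi$ (with $v_\xi(0)=+\infty$). Let $d\ge 1$ and let $x\in k(X)$ be a function that is regular on $X-\{\infty\}$ and has a pole of order $d$ at $\infty$, such that the extension $k(X)/k(x)$ is separable. Let $\pi:X\to\mathbb P^1$ be the morphism defined by $x$, let $e_\xi$ be its ramification degree at $\xi$ (so $e_\infty=d$), let $R$ be the set of points $\xi$ with $e_\xi\ge 2$, and put $U=X-R$. For a point $\xi$ and a uniformizer $t$ at $\xi$, write $\sum_{m\ge 0}b_mt^m$ ($b_m\in k$) for the expansion in $\widehat{\mathcal O}_{X,\xi}=k[[t]]$ of $x$ if $\xi\ne\infty$, and of $1/x$ if $\xi=\infty$; let $r_\xi$ be the smallest integer $m$ whose image in $k$ is non-zero (that is, $m$ is prime to $p$ if $p>0$, and $m\neq 0$ if $p=0$) and for which $b_m\ne 0$. The standard Hasse--Schmidt derivation of $k(x)$, given by $k$-linear maps $D_n$ with $D_n(x^m)=\binom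 mn x^{m-n}$ for all $m\in\mathbb Z$, $n\ge 0$, has a unique extension $D=(D_n)_{n\ge0}$ to a Hasse--Schmidt derivation of $k(X)$ over $k$. Let $f\in\mathcal O_X(U)$. Then, for all $n\ge 1$, $D_n(f)\in\mathcal O_X(U)$, $$v_\xi(D_n(f))\ \ge\ (n-1)e_\xi-(2n-1)r_\xi+v_\xi(f)\qquad\text{for all }\xi\in R,\ \xi\neq\infty,$$ $$v_\infty(D_n(f))\ \ge\ (3n-1)d-(2n-1)r_\infty+v_\infty(f),$$ whatever the choice of the uniformizers used to define $r_\xi$ and $r_\infty$. -/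

import Mathlib

open AlgebraicGeometry CategoryTheory

open scoped IntermediateField

universe u

/-- A Hasse–Schmidt derivation of a commutative `k`-algebra `K`, trivial on `k`: a sequence
`(D_n)_{n ≥ 0}` of `k`-linear maps with `D_0 = id` and
`D_n (f g) = ∑_{i + j = n} D_i f * D_j g`. -/
structure HasseSchmidtDerivation (k K : Type*) [CommRing k] [CommRing K] [Algebra k K] where
  /-- The components `D_n`. -/
  D : ℕ → K →ₗ[k] K
  zero_eq_id : D 0 = LinearMap.id
  leibniz : ∀ (n : ℕ) (f g : K),
    D n (f * g) = ∑ ij ∈ Finset.HasAntidiagonal.antidiagonal n, D ij.1 f * D ij.2 g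

/-- `D` restricts on `k(x)` to the standard Hasse–Schmidt derivation with respect to `x`,
that is, `D_n (x ^ m) = (m choose n) x ^ (m - n)` for all integers `m` and all `n ≥ 0`. -/
def HasseSchmidtDerivation.ExtendsStandard {k K : Type*} [CommRing k] [Field K] [Algebra k K]
    (D : HasseSchmidtDerivation k K) (x : K) : Prop :=
  ∀ (m : ℤ) (n : ℕ), D.D n (x ^ m) = ((Ring.choose m n : ℤ) : K) * x ^ (m - (n : ℤ))

/-- An integral smooth proper curve over the field `k`. -/
structure SmoothProperCurve (k : Type u) [Field k] where
  /-- The underlying scheme. -/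
  X : Scheme.{u}
  /-- The structure morphism. -/
  hom : X ⟶ Spec (.of k)
  isIntegral : AlgebraicGeometry.IsIntegral X
  smooth : SmoothOfRelativeDimension 1 hom
  proper : IsProper hom

namespace SmoothProperCurve

attribute [instance] isIntegral smooth proper

variable {k : Type u} [Field k] (C : SmoothProperCurve k)

instance : IsLocallyNoetherian C.X :=
  LocallyOfFiniteType.isLocallyNoetherian C.hom

/-- The function field `k(X)`. -/
abbrev FunctionField : Type u := C.X.functionField

/-- The inclusion of the constants `k` in `k(X)`, induced by the structure morphism. -/
noncomputable def const : k →+* C.FunctionField :=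
  ((Scheme.ΓSpecIso (.of k)).inv ≫ C.hom.appTop ≫ C.X.presheaf.germ ⊤ (genericPoint C.X) trivial).hom

noncomputable instance : Algebra k C.FunctionField := C.const.toAlgebra

/-- The (closed) points of the curve. -/
def Point : Type u := {ξ : C.X // IsClosed ({ξ} : Set C.X)}

/-- The rational function `f` is regular at `ξ`: it belongs to the local ring at `ξ`. -/
def RegularAt (f : C.FunctionField) (ξ : C.Point) : Prop :=
  f ∈ (algebraMap (C.X.presheaf.stalk ξ.1) C.FunctionField).range

/-- The rational function `f` is regular on the set `U` of points of the curve. -/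
def RegularOn (f : C.FunctionField) (U : Set C.Point) : Prop :=
  ∀ ξ ∈ U, C.RegularAt f ξ

open scoped Classical in
/-- The valuation `v_ξ` of the function field: the order of vanishing at `ξ`,
with `v_ξ 0 = ∞`. -/
noncomputable def val (ξ : C.Point) (f : C.FunctionField) : WithTop ℤ :=
  if f = 0 then ⊤ else ((Scheme.ord f ξ.1 : ℤ) : WithTop ℤ)

/-- The value `f(ξ) ∈ k` of a function `f` regular at `ξ`: the constant `c` such that `f - c`
vanishes at `ξ`. -/
noncomputable def value (ξ : C.Point) (f : C.FunctionField) : k :=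
  Classical.epsilon fun c : k => 0 < C.val ξ (f - algebraMap k C.FunctionField c)

/-- `b = ∑ b_m T ^ m` is the expansion at `ξ` of the function `f` in powers of `t`:
for every `N`, `f` agrees with `∑_{m < N} b_m t ^ m` to order at least `N` at `ξ`. -/
def IsExpansion (ξ : C.Point) (t f : C.FunctionField) (b : PowerSeries k) : Prop :=
  ∀ N : ℕ, (((N : ℤ)) : WithTop ℤ) ≤ C.val ξ (f - Polynomial.aeval t (PowerSeries.trunc N b))

/-- The expansion at `ξ` of a function `f` regular at `ξ` in powers of a uniformizer `t` at `ξ`,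
i.e. the image of `f` in the completed local ring, identified with `k⟦t⟧`. -/
noncomputable def expansion (ξ : C.Point) (t f : C.FunctionField) : PowerSeries k :=
  Classical.epsilon fun b : PowerSeries k => C.IsExpansion ξ t f b

open scoped Classical in
/-- The pull-back, under the morphism `π : X ⟶ ℙ¹` defined by `x`, of the coordinate of `ℙ¹`
used near `π(ξ)`: it is `x` when `ξ ≠ ∞` and `1 / x` when `ξ = ∞`, the unique pole of `x`. -/
noncomputable def coord (inf : C.Point) (x : C.FunctionField) (ξ : C.Point) : C.FunctionField :=
  if ξ = inf then x⁻¹ else x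

/-- The ramification degree `e_ξ` of `π` at `ξ`: the order of vanishing at `ξ` of the pull-back
of a uniformizer at `π(ξ)`. -/
noncomputable def ramDegree (inf : C.Point) (x : C.FunctionField) (ξ : C.Point) : ℤ :=
  Scheme.ord
    (C.coord inf x ξ - algebraMap k C.FunctionField (C.value ξ (C.coord inf x ξ))) ξ.1

/-- The set of ramification points of `π`. -/
def ramSet (inf : C.Point) (x : C.FunctionField) : Set C.Point :=
  {ξ | 2 ≤ C.ramDegree inf x ξ}

/-- The integer `r_ξ`: the smallest `m` that is prime to the characteristic of `k`, in the sense
that `m ≠ 0` in `k`, and such that the coefficient `b_m` of the expansion of `x`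
(of `1 / x` when `ξ = ∞`) at `ξ` in powers of the uniformizer `t` is not zero. -/
noncomputable def ramR (inf : C.Point) (x : C.FunctionField) (ξ : C.Point)
    (t : C.FunctionField) : ℕ :=
  sInf {m : ℕ | (m : k) ≠ 0 ∧ PowerSeries.coeff m (C.expansion ξ t (C.coord inf x ξ)) ≠ 0}

end SmoothProperCurve

/-! A Hasse–Schmidt derivation of K = k(X) amounts to a ring homomorphism φ : K → K⟦T⟧, f ↦ ∑ D_n(f)
T^n, that fixes k and reduces to the identity at T = 0. By separability K is formally étale over
k[x], so exactly one such φ sends x to x + T (`existsUnique_lift_of_formallyEtale`).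

The local ring at ξ is formally étale over a polynomial ring. This yields a uniformizer t and a
Taylor homomorphism θ(f) = f(t + T), whose j-th coefficient lowers orders by at most j. Uniqueness
of étale lifts gives φ(f) = θ(f)(τ) with τ = φ(t) - t (`IsTaylorExpansion`).

Let y be x, or 1/x at ∞. Since φ(y) is explicit, θ(y)(τ) = φ(y) is an implicit equation for τ. Its
linear coefficient dy/dt is nonzero by separability and has order r - 1
(`map_derivation_eq_of_expansion`); the coefficient of index j has order at least e - j. Solving
recursively (`le_map_coeff_of_subst_eq`) gives v(τ_n) ≥ nw + r - e + 1, with w = e - 2r at finite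
points and w = 3d - 2r at ∞. Substituting τ into θ(f) gives v(D_n f) ≥ nw + r - e + v(f), which is
the claim. Outside R, dy/dt is a unit and the same recursion preserves regularity. -/

namespace PowerSeries

/-! ### Lifting to power series along formally étale algebras -/

theorem iInf_span_X_pow_eq_bot (Q : Type*) [CommRing Q] :
    ⨅ i : ℕ, (Ideal.span {(X : PowerSeries Q)}) ^ i = ⊥ := by
  refine eq_bot_iff.2 fun f hf => ?_
  rw [Ideal.mem_bot]
  ext n
  have h := (Ideal.mem_iInf.1 hf) (n + 1)
  rw [Ideal.span_singleton_pow, Ideal.mem_span_singleton, X_pow_dvd_iff] at h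
  simpa using h n (Nat.lt_succ_self n)

/-- Along a formally étale algebra, a deformation of the base deforms the algebra uniquely. -/
theorem existsUnique_lift_of_formallyEtale {R S Q : Type*} [CommRing R] [CommRing S] [CommRing Q]
    [Algebra R S] [Algebra.FormallyEtale R S] (g : R →+* PowerSeries Q) (σ : S →+* Q)
    (h : (constantCoeff (R := Q)).comp g = σ.comp (algebraMap R S)) :
    ∃! φ : S →+* PowerSeries Q, φ.comp (algebraMap R S) = g ∧
      (constantCoeff (R := Q)).comp φ = σ := by
  let _ : Algebra R (PowerSeries Q) := g.toAlgebra
  have key : ∀ a b : PowerSeries Q, Ideal.Quotient.mk (Ideal.span {(X : PowerSeries Q)}) a =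
      Ideal.Quotient.mk _ b ↔ constantCoeff a = constantCoeff b := by
    intro a b
    rw [Ideal.Quotient.eq, Ideal.mem_span_singleton, X_dvd_iff, map_sub, sub_eq_zero]
  let f : S →ₐ[R] PowerSeries Q ⧸ Ideal.span {(X : PowerSeries Q)} :=
    { ((Ideal.Quotient.mk _).comp ((C (R := Q)).comp σ)) with
      commutes' := fun r => by
        change Ideal.Quotient.mk _ (C (σ (algebraMap R S r))) = Ideal.Quotient.mk _ (g r)
        rw [key]
        simpa using (congr($h r)).symm }
  -- Existence: formal smoothness together with X-adic completeness.
  obtain ⟨φ, hφ⟩ := Algebra.FormallySmooth.exists_mkₐ_comp_eq_of_isAdicComplete f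
  refine ⟨φ.toRingHom, ⟨φ.comp_algebraMap, ?_⟩, ?_⟩
  · ext s
    have : Ideal.Quotient.mk (Ideal.span {(X : PowerSeries Q)}) (φ s) =
      Ideal.Quotient.mk _ (C (σ s)) := congr($hφ s)
    simpa using (key _ _).1 this
  · rintro ψ ⟨h1, h2⟩
    let ψ' : S →ₐ[R] PowerSeries Q := { ψ with commutes' := fun r => congr($h1 r) }
    -- Uniqueness: lifts that agree modulo X agree modulo every power of X by unramifiedness, and
    -- these powers intersect in 0.
    have : ψ' = φ := by
      refine Algebra.FormallyUnramified.ext_of_iInf (R := R) _ (iInf_span_X_pow_eq_bot Q)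
        fun s => ?_
      have h3 : Ideal.Quotient.mk (Ideal.span {(X : PowerSeries Q)}) (φ s) =
        Ideal.Quotient.mk _ (C (σ s)) := congr($hφ s)
      rw [h3, key]
      exact congr($h2 s)
    exact congr(($this).toRingHom)

/-- The binomial expansion of `φ (x ^ m)` when `φ x = x + T`. -/
theorem coeff_map_zpow {K : Type*} [Field K] (φ : K →+* PowerSeries K) {x : K} (hx : x ≠ 0)
    (hφ : φ x = C x + X) (m : ℤ) (n : ℕ) :
    coeff n (φ (x ^ m)) = ((Ring.choose m n : ℤ) : K) * x ^ (m - (n : ℤ)) := by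
  -- The candidate for (x + T)^m; Pascal's rule gives the recursion in `hg`, which determines it in
  -- both directions from m = 0.
  let g : ℤ → PowerSeries K := fun m => mk fun n => ((Ring.choose m n : ℤ) : K) * x ^ (m - (n : ℤ))
  have hg : ∀ m, g m * φ x = g (m + 1) := by
    intro m
    ext n
    rw [hφ, mul_add, map_add, mul_comm _ (C x), coeff_C_mul]
    rcases n with _ | n
    · simp [g, zpow_add₀ hx, mul_comm]
    · simp only [coeff_succ_mul_X, g, coeff_mk, Ring.choose_succ_succ]
      have e1 : m + 1 - ((n + 1 : ℕ) : ℤ) = m - n := by push_cast; ring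
      have e2 : m - (n : ℤ) = (m - ((n + 1 : ℕ) : ℤ)) + 1 := by push_cast; ring
      rw [e1, e2, zpow_add_one₀ hx]
      push_cast
      ring
  have hu : φ x ≠ 0 := by
    intro h
    exact hx ((_root_.map_eq_zero φ).1 h)
  have main : ∀ m, φ (x ^ m) = g m := by
    intro m
    induction m with
    | zero =>
      ext n
      rcases n with _ | n <;> simp [g, coeff_one, Ring.choose_zero_succ]
    | succ i ih => rw [← hg, ← ih, zpow_add_one₀ hx, map_mul]
    | pred i ih =>
      have h1 := hg (-(i : ℤ) - 1)
      rw [sub_add_cancel, ← ih] at h1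
      have h2 : φ (x ^ (-(i : ℤ) - 1)) * φ x = φ (x ^ (-(i : ℤ))) := by
        rw [← map_mul, ← zpow_add_one₀ hx, sub_add_cancel]
      exact mul_right_cancel₀ hu (h2.trans h1.symm)
  rw [main]
  simp [g]

end PowerSeries

/-! ### Hasse–Schmidt derivations as homomorphisms to power series -/

namespace HasseSchmidtDerivation

open PowerSeries

variable {k K : Type*} [Field k] [Field K] [Algebra k K]

@[ext]
theorem ext' {D E : HasseSchmidtDerivation k K} (h : ∀ n f, D.D n f = E.D n f) : D = E := by
  cases D; cases E
  congr
  funext n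
  exact LinearMap.ext (h n)

/-- The generating series `f ↦ ∑ D_n(f) T ^ n`. -/
noncomputable def toSeries (D : HasseSchmidtDerivation k K) : K →+* PowerSeries K :=
  have hmul : ∀ f g : K, (PowerSeries.mk fun n => D.D n (f * g)) =
      (PowerSeries.mk fun n => D.D n f) * (PowerSeries.mk fun n => D.D n g : PowerSeries K) := fun f g => by
    ext n
    simp [coeff_mul, D.leibniz]
  have hone : (PowerSeries.mk fun n => D.D n 1 : PowerSeries K) = 1 := by
    have h := hmul 1 1
    rw [mul_one] at h
    -- The Leibniz rule only makes the series of 1 idempotent; having constant term 1, it is nonzero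
    -- in a domain, hence equal to 1.
    have h0 : (PowerSeries.mk fun n => D.D n 1 : PowerSeries K) ≠ 0 := fun h0 => by
      simpa [D.zero_eq_id] using congr(coeff 0 $h0)
    exact (mul_left_cancel₀ h0 (by rw [mul_one]; exact h)).symm
  { toFun := fun f => PowerSeries.mk fun n => D.D n f
    map_one' := hone
    map_mul' := hmul
    map_zero' := by ext; simp
    map_add' := fun f g => by ext; simp }

@[simp]
theorem coeff_toSeries (D : HasseSchmidtDerivation k K) (n : ℕ) (f : K) :
    coeff n (D.toSeries f) = D.D n f := by simp [toSeries]

theorem constantCoeff_toSeries (D : HasseSchmidtDerivation k K) (f : K) :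
    constantCoeff (D.toSeries f) = f := by
  rw [← coeff_zero_eq_constantCoeff_apply, coeff_toSeries, D.zero_eq_id, LinearMap.id_apply]

theorem toSeries_algebraMap (D : HasseSchmidtDerivation k K) (c : k) :
    D.toSeries (algebraMap k K c) = C (algebraMap k K c) := by
  have h1 := D.toSeries.map_one
  ext n
  rw [coeff_toSeries, Algebra.algebraMap_eq_smul_one, map_smul, ← coeff_toSeries, h1, coeff_one,
    coeff_C]
  split_ifs <;> simp

theorem ExtendsStandard.toSeries_eq {D : HasseSchmidtDerivation k K} {x : K}
    (h : D.ExtendsStandard x) : D.toSeries x = C x + X := by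
  ext n
  have h1 := h 1 n
  rw [zpow_one] at h1
  rw [coeff_toSeries, h1]
  rcases n with _ | _ | n
  · simp
  · simp [coeff_X]
  · have : Ring.choose (1 : ℤ) (n + 2) = 0 := by
      have := Ring.choose_natCast (R := ℤ) 1 (n + 2)
      rw [Nat.choose_eq_zero_of_lt (by omega)] at this
      simpa using this
    simp [this, coeff_X]

theorem ExtendsStandard.apply_self {D : HasseSchmidtDerivation k K} {x : K}
    (h : D.ExtendsStandard x) {n : ℕ} (hn : 1 ≤ n) : D.D n x = if n = 1 then 1 else 0 := by
  rw [← D.coeff_toSeries, h.toSeries_eq, map_add, coeff_C, if_neg (by omega), zero_add, coeff_X]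

/-- The Hasse–Schmidt derivation with a given generating series. -/
noncomputable def ofSeries (φ : K →+* PowerSeries K) (h0 : ∀ f, constantCoeff (φ f) = f)
    (hk : ∀ c : k, φ (algebraMap k K c) = C (algebraMap k K c)) : HasseSchmidtDerivation k K where
  D n :=
    { toFun := fun f => coeff n (φ f)
      map_add' := fun f g => by simp
      map_smul' := fun c f => by simp [Algebra.smul_def, hk, coeff_C_mul] }
  zero_eq_id := by
    ext f
    simpa using h0 f
  leibniz n f g := by simp [coeff_mul]

open scoped IntermediateField.algebraAdjoinAdjoin in
/-- The standard Hasse–Schmidt derivation of `k(x)` extends uniquely to a separable extension. -/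
theorem existsUnique_extendsStandard {x : K} (hx : Transcendental k x)
    (hsep : Algebra.IsSeparable k⟮x⟯ K) :
    ∃! D : HasseSchmidtDerivation k K, D.ExtendsStandard x := by
  have hx0 : x ≠ 0 := by
    rintro rfl
    exact hx isAlgebraic_zero
  let R := Algebra.adjoin k {x}
  have : Algebra.FormallyEtale k⟮x⟯ K := Algebra.FormallyEtale.of_isSeparable _ _
  have : Algebra.FormallyEtale R k⟮x⟯ :=
    Algebra.FormallyEtale.of_isLocalization (nonZeroDivisors R)
  have : IsScalarTower R k⟮x⟯ K := IsScalarTower.of_algebraMap_eq fun _ => rfl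
  have : Algebra.FormallyEtale R K := Algebra.FormallyEtale.comp R k⟮x⟯ K
  let e : Polynomial k ≃ₐ[k] R := AlgEquiv.ofInjective (Polynomial.aeval x)
    (transcendental_iff_injective.1 hx) |>.trans
      (Subalgebra.equivOfEq _ _ (Algebra.adjoin_singleton_eq_range_aeval k x).symm)
  have he : ∀ p, (e p : K) = Polynomial.aeval x p := fun p => rfl
  -- The deformation x ↦ x + T of k[x], to be lifted along k[x] → k(x) → K.
  let g : R →+* PowerSeries K :=
    (Polynomial.eval₂RingHom ((C (R := K)).comp (algebraMap k K)) (C x + X)).comp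
      (e.symm : R →+* Polynomial k)
  have hg : (constantCoeff (R := K)).comp g = (RingHom.id K).comp (algebraMap R K) := by
    have : ((constantCoeff (R := K)).comp g).comp (e : Polynomial k →+* R) =
        ((RingHom.id K).comp (algebraMap R K)).comp (e : Polynomial k →+* R) := by
      refine Polynomial.ringHom_ext (fun c => ?_) ?_
      · simp [g]; exact (congr_arg Subtype.val (e.commutes c)).symm
      · simp [g]
        exact ((he Polynomial.X).trans (Polynomial.aeval_X x)).symm
    ext r
    obtain ⟨p, rfl⟩ := e.surjective r
    exact congr($this p)
  obtain ⟨φ, ⟨hφ1, hφ2⟩, huniq⟩ := existsUnique_lift_of_formallyEtale g (RingHom.id K) hg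
  have hφe : ∀ p : Polynomial k, φ (Polynomial.aeval x p) =
      Polynomial.eval₂ ((C (R := K)).comp (algebraMap k K)) (C x + X) p := fun p => by
    have h := congr($hφ1 (e p))
    simp only [g, RingHom.comp_apply] at h
    rw [← he]
    refine h.trans ?_
    simp
  have hφx : φ x = C x + X := by simpa using hφe Polynomial.X
  refine ⟨ofSeries φ (fun f => congr($hφ2 f)) fun c => by simpa using hφe (Polynomial.C c),
    fun m n => coeff_map_zpow φ hx0 hφx m n, fun E hE => ?_⟩
  have hE' : E.toSeries = φ := by
    refine huniq _ ⟨?_, ?_⟩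
    · ext1 r
      obtain ⟨p, rfl⟩ := e.surjective r
      have : (E.toSeries.comp (algebraMap R K)).comp (e : Polynomial k →+* R) =
          g.comp (e : Polynomial k →+* R) := by
        refine Polynomial.ringHom_ext (fun c => ?_) ?_
        · simp [g]
          exact (congr_arg E.toSeries (congr_arg Subtype.val (e.commutes c))).trans
            (E.toSeries_algebraMap c)
        · simp [g]
          exact (congr_arg E.toSeries ((he Polynomial.X).trans (Polynomial.aeval_X x))).trans
            hE.toSeries_eq
      exact congr($this p)
    · ext1 f
      exact E.constantCoeff_toSeries f
  ext n f
  rw [← coeff_toSeries, hE']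
  rfl

end HasseSchmidtDerivation

/-- A derivation of a separable extension of `k(x)` killing `x` vanishes. -/
theorem Derivation.eq_zero_of_apply_eq_zero_of_isSeparable {k K : Type*} [Field k] [Field K]
    [Algebra k K] {x : K} (hsep : Algebra.IsSeparable k⟮x⟯ K) (D : Derivation k K K)
    (hD : D x = 0) : D = 0 := by
  have h0 : ∀ a ∈ k⟮x⟯, D a = 0 := by
    intro a ha
    induction ha using IntermediateField.adjoin_induction with
    | mem y hy => rw [Set.mem_singleton_iff.1 hy, hD]
    | algebraMap c => exact D.map_algebraMap c
    | add a b _ _ ha hb => rw [map_add, ha, hb, add_zero]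
    | inv a _ ha => rw [D.leibniz_inv, ha, smul_zero]
    | mul a b _ _ ha hb => rw [D.leibniz, ha, hb, smul_zero, smul_zero, add_zero]
  let L : K →ₗ[k⟮x⟯] K :=
    { toFun := D
      map_add' := map_add D
      map_smul' := fun a f => by
        change D ((a : K) * f) = (a : K) * D f
        rw [D.leibniz, h0 a a.2, smul_zero, add_zero, smul_eq_mul] }
  let E : Derivation k⟮x⟯ K K := Derivation.mk' L fun a b => D.leibniz a b
  -- The derivation is k(x)-linear, and separability makes the differentials of K over k(x) vanish.
  have : Algebra.FormallyUnramified k⟮x⟯ K := Algebra.FormallyUnramified.of_isSeparable _ _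
  have hE : E = 0 := by
    apply (KaehlerDifferential.linearMapEquivDerivation k⟮x⟯ K).symm.injective
    exact LinearMap.ext fun a => by rw [Subsingleton.elim a 0, map_zero, map_zero]
  ext f
  exact congr($hE f)

/-! ### Valuation bounds for coefficients of powers and substitutions -/

namespace AddValuation

variable {K : Type*} [Field K] (v : AddValuation K (WithTop ℤ))

theorem coe_le_map_mul {a b c : ℤ} {f g : K} (hf : (a : WithTop ℤ) ≤ v f)
    (hg : (b : WithTop ℤ) ≤ v g) (h : c ≤ a + b) : (c : WithTop ℤ) ≤ v (f * g) := by
  rw [v.map_mul]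
  exact (WithTop.coe_le_coe.2 h).trans (by rw [WithTop.coe_add]; exact add_le_add hf hg)

theorem coe_le_of_le {a b : ℤ} {f : K} (h : a ≤ b) (hf : (b : WithTop ℤ) ≤ v f) :
    (a : WithTop ℤ) ≤ v f :=
  (WithTop.coe_le_coe.2 h).trans hf

theorem coe_le_of_coe_le_mul {a b c : ℤ} {f g : K} (hf : v f = (a : WithTop ℤ))
    (hfg : (b : WithTop ℤ) ≤ v (f * g)) (h : c ≤ b - a) : (c : WithTop ℤ) ≤ v g := by
  rw [v.map_mul, hf] at hfg
  induction hg : v g using WithTop.recTopCoe with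
  | top => exact le_top
  | coe m =>
    rw [hg, ← WithTop.coe_add, WithTop.coe_le_coe] at hfg
    exact WithTop.coe_le_coe.2 (by omega)

theorem map_zpow_eq {t : K} (ht : v t = 1) (m : ℤ) : v (t ^ m) = (m : WithTop ℤ) := by
  have ht0 : t ≠ 0 := v.ne_top_iff.1 (by rw [ht]; exact WithTop.coe_ne_top (a := (1 : ℤ)))
  have hnat : ∀ n : ℕ, v (t ^ n) = ((n : ℤ) : WithTop ℤ) := fun n => by
    rw [v.map_pow, ht]; simp
  obtain ⟨n, rfl | rfl⟩ := m.eq_nat_or_neg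
  · rw [zpow_natCast, hnat]
  · have h1 : v (t ^ (-(n : ℤ))) + v (t ^ n) = 0 := by
      rw [← v.map_mul, zpow_neg, zpow_natCast, inv_mul_cancel₀ (pow_ne_zero n ht0), v.map_one]
    rw [hnat] at h1
    induction hg : v (t ^ (-(n : ℤ))) using WithTop.recTopCoe with
    | top =>
      rw [hg, top_add] at h1
      exact absurd h1 WithTop.top_ne_zero
    | coe m =>
      rw [hg, ← WithTop.coe_add, ← WithTop.coe_zero, WithTop.coe_inj] at h1
      rw [WithTop.coe_inj]
      omega

theorem zero_le_map_intCast (n : ℤ) : (0 : WithTop ℤ) ≤ v (n : K) := by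
  have h : ∀ n : ℕ, (0 : WithTop ℤ) ≤ v (n : K) := fun n => by
    induction n with
    | zero => simp
    | succ n ih =>
      rw [Nat.cast_succ]
      exact v.map_le_add ih v.map_one.ge
  obtain ⟨n, rfl | rfl⟩ := n.eq_nat_or_neg
  · simpa using h n
  · simpa [v.map_neg] using h n

open PowerSeries

/-- A linear lower bound for the coefficients of a power series gives one for its powers. -/
theorem le_map_coeff_pow {τ : PowerSeries K} (h0 : constantCoeff τ = 0) {w α : ℤ} {n : ℕ}
    (h : ∀ i < n, ((i * w + α : ℤ) : WithTop ℤ) ≤ v (coeff i τ)) (j m : ℕ) (hm : m < n + j) :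
    ((m * w + (j + 1) * α : ℤ) : WithTop ℤ) ≤ v (coeff m (τ ^ (j + 1))) := by
  induction j generalizing m with
  | zero => simpa using h m hm
  | succ j ih =>
    rw [pow_succ, coeff_mul]
    refine v.map_le_sum fun ab hab => ?_
    rw [Finset.HasAntidiagonal.mem_antidiagonal] at hab
    obtain ⟨a, b⟩ := ab
    simp only at hab ⊢
    rcases Nat.eq_zero_or_pos b with rfl | hb
    · simp [h0]
    -- As τ^(j+1) starts in degree j + 1, only a ≥ j + 1 contributes, which forces b < n; and b ≥ 1
    -- keeps a in the range of the induction hypothesis.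
    by_cases ha : a < j + 1
    · have : coeff a (τ ^ (j + 1)) = 0 :=
        X_pow_dvd_iff.1 (pow_dvd_pow_of_dvd (X_dvd_iff.2 h0) (j + 1)) a ha
      simp [this]
    · refine v.coe_le_map_mul (ih a (by omega)) (h b (by omega)) (le_of_eq ?_)
      rw [← hab]
      push_cast
      ring

theorem coeff_subst_eq_sum {τ : PowerSeries K} (h0 : constantCoeff τ = 0) (g : PowerSeries K)
    (n : ℕ) :
    coeff n (g.subst τ) = ∑ j ∈ Finset.range (n + 1), coeff j g * coeff n (τ ^ j) := by
  rw [coeff_subst' (HasSubst.of_constantCoeff_zero' h0)]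
  refine (finsum_eq_sum_of_support_subset _ fun j hj => ?_)
  by_contra hlt
  have hlt : n < j := by simpa using hlt
  have : coeff n (τ ^ j) = 0 :=
    X_pow_dvd_iff.1 (pow_dvd_pow_of_dvd (X_dvd_iff.2 h0) j) n hlt
  simp [this] at hj

/-- The term -jα in the bound on g cancels the jα gained from τ^j, so all terms obey the same bound.
-/
theorem le_map_coeff_subst {τ : PowerSeries K} (h0 : constantCoeff τ = 0) {w α : ℤ}
    (h : ∀ i : ℕ, ((i * w + α : ℤ) : WithTop ℤ) ≤ v (coeff i τ)) (g : PowerSeries K) (G : ℤ)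
    (hg : ∀ j : ℕ, 1 ≤ j → ((G - j * α : ℤ) : WithTop ℤ) ≤ v (coeff j g)) (n : ℕ) (hn : 1 ≤ n) :
    ((n * w + G : ℤ) : WithTop ℤ) ≤ v (coeff n (g.subst τ)) := by
  rw [coeff_subst_eq_sum h0]
  refine v.map_le_sum fun j _ => ?_
  rcases j with _ | j
  · simp [coeff_one, show n ≠ 0 by omega]
  · refine v.coe_le_map_mul (hg (j + 1) (by omega))
      (v.le_map_coeff_pow h0 (n := n + 1) (fun i _ => h i) j n (by omega)) (le_of_eq ?_)
    push_cast
    ring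

/-- Lower bounds for the coefficients of a solution `τ` of the equation `g(τ) - g(0) = η`. -/
theorem le_map_coeff_of_subst_eq {g τ η : PowerSeries K} (h0 : constantCoeff τ = 0)
    (heq : g.subst τ = C (constantCoeff g) + η) {w α ρ : ℤ}
    (hρ : v (coeff 1 g) = (ρ : WithTop ℤ))
    (hη : ∀ n : ℕ, 1 ≤ n → ((n * w + α + ρ : ℤ) : WithTop ℤ) ≤ v (coeff n η))
    (hg : ∀ j : ℕ, 2 ≤ j → ((α + ρ - j * α : ℤ) : WithTop ℤ) ≤ v (coeff j g)) (n : ℕ) :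
    ((n * w + α : ℤ) : WithTop ℤ) ≤ v (coeff n τ) := by
  induction n using Nat.strong_induction_on with
  | _ n ih =>
    rcases n with _ | n
    · simp [h0]
    have h1 := congr(coeff (n + 1) $heq)
    rw [coeff_subst_eq_sum h0, Finset.sum_range_succ', Finset.sum_range_succ'] at h1
    simp only [_root_.map_add, coeff_C, zero_add, pow_one, pow_zero, coeff_one, Nat.succ_ne_zero,
      if_false, mul_zero, add_zero] at h1
    -- The linear term of the equation isolates the coefficient of τ of index n + 1; the powers τ^j
    -- with j ≥ 2 involve only earlier coefficients.
    refine v.coe_le_of_coe_le_mul hρ (b := (n + 1 : ℕ) * w + α + ρ) ?_ (by omega)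
    rw [← eq_sub_iff_add_eq'] at h1
    rw [h1]
    refine v.map_le_sub (hη _ (by omega)) (v.map_le_sum fun j _ => ?_)
    refine v.coe_le_map_mul (hg (j + 1 + 1) (by omega))
      (v.le_map_coeff_pow h0 ih (j + 1) (n + 1) (by omega)) (le_of_eq ?_)
    push_cast
    ring

end AddValuation

/-! ### Taylor expansions at a point and the basic estimate -/

section TaylorExpansion

open PowerSeries

/-- The expansion `θ` of functions around the generic point with respect to a uniformizer `t` of a
valuation `v` with residue field `k`: `θ(f) = f(t + T)`. -/
structure IsTaylorExpansion (k : Type*) {K : Type*} [Field k] [Field K] [Algebra k K]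
    (v : AddValuation K (WithTop ℤ)) (t : K) (θ : K →+* PowerSeries K) : Prop where
  exists_residue : ∀ f, 0 ≤ v f → ∃ c : k, 0 < v (f - algebraMap k K c)
  map_uniformizer : v t = 1
  map_algebraMap : ∀ c : k, c ≠ 0 → v (algebraMap k K c) = 0
  constantCoeff_eq : ∀ f, constantCoeff (θ f) = f
  apply_algebraMap : ∀ c : k, θ (algebraMap k K c) = C (algebraMap k K c)
  apply_uniformizer : θ t = C t + X
  map_coeff_nonneg : ∀ f, 0 ≤ v f → ∀ n, 0 ≤ v (coeff n (θ f))
  eq_subst : ∀ φ : K →+* PowerSeries K, (∀ f, constantCoeff (φ f) = f) →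
    (∀ c : k, φ (algebraMap k K c) = C (algebraMap k K c)) →
    ∀ f, φ f = (θ f).subst (φ t - C t)

namespace IsTaylorExpansion

variable {k K : Type*} [Field k] [Field K] [Algebra k K] {v : AddValuation K (WithTop ℤ)} {t : K}
  {θ : K →+* PowerSeries K} (h : IsTaylorExpansion k v t θ)
include h

theorem uniformizer_ne_zero : t ≠ 0 :=
  v.ne_top_iff.1 (by rw [h.map_uniformizer]; exact WithTop.coe_ne_top (a := (1 : ℤ)))

/-- Factor f = t^m g with g integral: the coefficients of θ(g) stay integral, and those of (t + T)^m
are integers times t^(m-a), also for negative m. -/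
theorem le_map_coeff {m : ℤ} {f : K} (hf : (m : WithTop ℤ) ≤ v f) (j : ℕ) :
    ((m - j : ℤ) : WithTop ℤ) ≤ v (coeff j (θ f)) := by
  have hg : ((0 : ℤ) : WithTop ℤ) ≤ v (t ^ (-m) * f) :=
    v.coe_le_map_mul (v.map_zpow_eq h.map_uniformizer _).ge hf (by omega)
  have e : f = t ^ m * (t ^ (-m) * f) := by
    rw [← mul_assoc, ← zpow_add₀ h.uniformizer_ne_zero, add_neg_cancel, zpow_zero, one_mul]
  rw [e, map_mul, coeff_mul]
  refine v.map_le_sum fun ab hab => ?_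
  rw [Finset.HasAntidiagonal.mem_antidiagonal] at hab
  obtain ⟨a, b⟩ := ab
  simp only at hab ⊢
  refine v.coe_le_map_mul (a := m - a) (b := 0) ?_ (h.map_coeff_nonneg _ hg b) (by omega)
  rw [coeff_map_zpow θ h.uniformizer_ne_zero h.apply_uniformizer]
  exact v.coe_le_map_mul (a := 0) (v.zero_le_map_intCast _)
    (v.map_zpow_eq h.map_uniformizer _).ge (by omega)

/-- The derivation `d/dt`. -/
noncomputable def derivation : Derivation k K K :=
  Derivation.mk'
    { toFun := fun f => coeff 1 (θ f)
      map_add' := fun f g => by simp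
      map_smul' := fun c f => by simp [Algebra.smul_def, h.apply_algebraMap, coeff_C_mul] }
    fun f g => by
      simp [coeff_mul, Finset.Nat.antidiagonal_succ, h.constantCoeff_eq, mul_comm]

theorem derivation_apply (f : K) : h.derivation f = coeff 1 (θ f) := rfl

theorem derivation_uniformizer : h.derivation t = 1 := by
  simp [derivation_apply, h.apply_uniformizer]

theorem le_map_derivation {m : ℤ} {f : K} (hf : (m : WithTop ℤ) ≤ v f) :
    ((m - 1 : ℤ) : WithTop ℤ) ≤ v (h.derivation f) := by
  exact_mod_cast h.le_map_coeff hf 1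

/-- With s = tu and u a unit, ds/dt = u + t du/dt, where the second term has positive order. This
makes the choice of uniformizer in r irrelevant. -/
theorem map_derivation_of_uniformizer {s : K} (hs : v s = 1) : v (h.derivation s) = 0 := by
  have h0 := h.uniformizer_ne_zero
  have e : h.derivation s = t ^ (-1 : ℤ) * s + t * h.derivation (t ^ (-1 : ℤ) * s) := by
    conv_lhs => rw [show s = t * (t ^ (-1 : ℤ) * s) by field_simp]
    rw [Derivation.leibniz, h.derivation_uniformizer, smul_eq_mul, smul_eq_mul]
    ring
  have hu : v (t ^ (-1 : ℤ) * s) = 0 := by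
    rw [v.map_mul, hs, v.map_zpow_eq h.map_uniformizer]
    rfl
  rw [e, v.map_add_eq_of_lt_left, hu]
  rw [hu]
  refine lt_of_lt_of_le (b := ((1 : ℤ) : WithTop ℤ)) (by exact_mod_cast one_pos) ?_
  exact v.coe_le_map_mul (a := 1) (b := 0) h.map_uniformizer.ge
    (h.map_coeff_nonneg _ hu.ge 1) (by omega)

theorem map_algebraMap_nonneg (c : k) : 0 ≤ v (algebraMap k K c) := by
  by_cases hc : c = 0
  · simp [hc]
  · exact (h.map_algebraMap c hc).ge

/-- Successive approximation: subtract the residue, divide by s, iterate. -/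
theorem exists_expansion {s : K} (hs : v s = 1) {f : K} (hf : 0 ≤ v f) :
    ∃ b : PowerSeries k, ∀ N : ℕ,
      ((N : ℤ) : WithTop ℤ) ≤ v (f - Polynomial.aeval s (trunc N b)) := by
  have hs0 : s ≠ 0 := v.ne_top_iff.1 (by rw [hs]; exact WithTop.coe_ne_top (a := (1 : ℤ)))
  have hstep : ∀ g : {g : K // 0 ≤ v g}, ∃ (c : k) (g' : {g : K // 0 ≤ v g}),
      g.1 = algebraMap k K c + s * g'.1 := by
    rintro ⟨g, hg⟩
    obtain ⟨c, hc⟩ := h.exists_residue g hg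
    refine ⟨c, ⟨s ^ (-1 : ℤ) * (g - algebraMap k K c), ?_⟩, ?_⟩
    · refine v.coe_le_map_mul (a := -1) (b := 1) (c := 0) (v.map_zpow_eq hs _).ge ?_ (by omega)
      induction hv : v (g - algebraMap k K c) using WithTop.recTopCoe with
      | top => exact le_top
      | coe m =>
        rw [hv] at hc
        have : 0 < m := by exact_mod_cast hc
        exact WithTop.coe_le_coe.2 (by omega)
    · field_simp
      ring
  choose c F hF using hstep
  refine ⟨PowerSeries.mk fun m => c (F^[m] ⟨f, hf⟩), fun N => ?_⟩
  have key : f - Polynomial.aeval s (trunc N (PowerSeries.mk fun m => c (F^[m] ⟨f, hf⟩))) =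
      s ^ N * (F^[N] ⟨f, hf⟩).1 := by
    induction N with
    | zero => simp
    | succ N ih =>
      rw [trunc_succ, map_add, ← sub_sub, ih, hF (F^[N] ⟨f, hf⟩), ← Function.iterate_succ_apply' F,
        Polynomial.aeval_monomial, coeff_mk]
      ring
  rw [key]
  refine v.coe_le_map_mul (a := N) (b := 0) ?_ (F^[N] ⟨f, hf⟩).2 (by omega)
  exact_mod_cast (v.map_zpow_eq hs N).ge

/-- The order of `dy/dt` in terms of the expansion of `y` in powers of any uniformizer. -/
theorem map_derivation_eq_of_expansion {s : K} (hs : v s = 1) {y : K} {b : PowerSeries k}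
    (hb : ∀ N : ℕ, ((N : ℤ) : WithTop ℤ) ≤ v (y - Polynomial.aeval s (trunc N b)))
    (hy : h.derivation y ≠ 0) :
    v (h.derivation y) = (((sInf {m : ℕ | (m : k) ≠ 0 ∧ coeff m b ≠ 0} : ℕ) : ℤ) - 1 : ℤ) := by
  set S := {m : ℕ | (m : k) ≠ 0 ∧ coeff m b ≠ 0}
  have hsplit : ∀ N : ℕ, h.derivation y =
      (∑ m ∈ Finset.range N, algebraMap k K (coeff m b * m) * s ^ (m - 1)) * h.derivation s +
        h.derivation (y - Polynomial.aeval s (trunc N b)) := fun N => by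
    have : h.derivation (Polynomial.aeval s (trunc N b)) =
        (∑ m ∈ Finset.range N, algebraMap k K (coeff m b * m) * s ^ (m - 1)) * h.derivation s := by
      rw [Derivation.map_aeval, smul_eq_mul]
      congr 1
      induction N with
      | zero => simp
      | succ N ih =>
        rw [trunc_succ, map_add, map_add, ih, Finset.sum_range_succ, Polynomial.derivative_monomial,
          Polynomial.aeval_monomial]
    rw [← this, ← map_add, add_sub_cancel]
  have hrem : ∀ N : ℕ, (((N : ℤ) - 1 : ℤ) : WithTop ℤ) ≤
      v (h.derivation (y - Polynomial.aeval s (trunc N b))) := fun N => h.le_map_derivation (hb N)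
  have hzero : ∀ m, m ∉ S → algebraMap k K (coeff m b * m) * s ^ (m - 1) = 0 := fun m hm => by
    have : coeff m b * (m : k) = 0 := by
      by_contra h0
      exact hm ⟨right_ne_zero_of_mul h0, left_ne_zero_of_mul h0⟩
    rw [this, map_zero, zero_mul]
  rcases S.eq_empty_or_nonempty with hS | hS
  -- If S were empty, dy/dt would have arbitrarily large order and vanish; so the default value
  -- `sInf ∅ = 0` does not occur.
  · exfalso
    induction hv : v (h.derivation y) using WithTop.recTopCoe with
    | top => exact hy (v.top_iff.1 hv)
    | coe n =>
      have h1 := hrem (n.toNat + 2)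
      have h2 := hsplit (n.toNat + 2)
      rw [Finset.sum_eq_zero fun m _ => hzero m (by simp [hS]), zero_mul, zero_add] at h2
      rw [← h2, hv, WithTop.coe_le_coe] at h1
      push_cast at h1
      omega
  · have hr := Nat.sInf_mem hS
    set r := sInf S
    have hr0 : r ≠ 0 := by
      intro h0
      exact hr.1 (by rw [h0, Nat.cast_zero])
    -- The term of index r has order exactly r - 1 because ds/dt is a unit; the remainder after r +
    -- 1 terms has order at least r.
    have hlead : v (algebraMap k K (coeff r b * r) * s ^ (r - 1) * h.derivation s) =
        ((r - 1 : ℤ) : WithTop ℤ) := by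
      have h1 := v.map_zpow_eq hs ((r - 1 : ℕ) : ℤ)
      rw [zpow_natCast] at h1
      rw [v.map_mul, v.map_mul, h.map_derivation_of_uniformizer hs,
        h.map_algebraMap _ (mul_ne_zero hr.2 hr.1), h1, zero_add, add_zero,
        Nat.cast_sub (by omega), Nat.cast_one]
    rw [hsplit (r + 1), Finset.sum_range_succ, Finset.sum_eq_zero fun m hm =>
      hzero m (Nat.notMem_of_lt_sInf (Finset.mem_range.1 hm)), zero_add,
      v.map_add_eq_of_lt_left, hlead]
    rw [hlead]
    refine lt_of_lt_of_le ?_ (hrem (r + 1))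
    exact WithTop.coe_lt_coe.2 (by push_cast; omega)

section Estimate

variable {φ : K →+* PowerSeries K} (hφ : ∀ f, constantCoeff (φ f) = f)
  (hφk : ∀ c : k, φ (algebraMap k K c) = C (algebraMap k K c))
include hφ hφk

/-- The basic estimate: bounds for the change `η` of one function `y` under `φ` and for the
derivatives of `y` give bounds for `φ`. -/
theorem le_map_coeff_of_bounds {y : K} {w α ρ : ℤ}
    (hρ : v (h.derivation y) = (ρ : WithTop ℤ))
    (hη : ∀ n : ℕ, 1 ≤ n → ((n * w + α + ρ : ℤ) : WithTop ℤ) ≤ v (coeff n (φ y)))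
    (hy : ∀ j : ℕ, 2 ≤ j → ((α + ρ - j * α : ℤ) : WithTop ℤ) ≤ v (coeff j (θ y)))
    {f : K} {G : ℤ}
    (hf : ∀ j : ℕ, 1 ≤ j → ((G - j * α : ℤ) : WithTop ℤ) ≤ v (coeff j (θ f)))
    {n : ℕ} (hn : 1 ≤ n) :
    ((n * w + G : ℤ) : WithTop ℤ) ≤ v (coeff n (φ f)) := by
  have h0 : constantCoeff (φ t - C t) = 0 := by simp [hφ]
  rw [h.eq_subst φ hφ hφk f]
  refine v.le_map_coeff_subst h0 (v.le_map_coeff_of_subst_eq (g := θ y) (η := φ y - C y) h0 ?_ hρ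
    (fun n hn => ?_) hy) _ _ hf n hn
  · rw [← h.eq_subst φ hφ hφk, h.constantCoeff_eq, add_sub_cancel]
  · rw [map_sub, coeff_C, if_neg (by omega), sub_zero]
    exact hη n hn

/-- The estimate at a point where `y` is a uniformizer up to a constant. -/
theorem map_coeff_nonneg_of_unramified {y : K} (hy0 : 0 ≤ v y)
    (hy : v (h.derivation y) = 0) (hη : ∀ n : ℕ, 1 ≤ n → 0 ≤ v (coeff n (φ y)))
    {f : K} (hf : 0 ≤ v f) {n : ℕ} (hn : 1 ≤ n) : 0 ≤ v (coeff n (φ f)) := by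
  have := h.le_map_coeff_of_bounds hφ hφk (y := y) (w := 0) (α := 0) (ρ := 0) (G := 0) (f := f) hy
    (fun n hn => by simpa using hη n hn) (fun j _ => by simpa using h.map_coeff_nonneg _ hy0 j)
    (fun j _ => by simpa using h.map_coeff_nonneg _ hf j) hn
  simpa using this

/-- The estimate at a ramified point. -/
theorem le_map_coeff_of_ramified {y : K} {c : k} {e r w : ℤ}
    (hc : v (y - algebraMap k K c) = (e : WithTop ℤ))
    (hr : v (h.derivation y) = ((r - 1 : ℤ) : WithTop ℤ))
    (hη : ∀ n : ℕ, 1 ≤ n → ((n * w + 2 * r - e : ℤ) : WithTop ℤ) ≤ v (coeff n (φ y)))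
    {f : K} {m : ℤ} (hf : (m : WithTop ℤ) ≤ v f) {n : ℕ} (hn : 1 ≤ n) :
    ((n * w + r - e + m : ℤ) : WithTop ℤ) ≤ v (coeff n (φ f)) := by
  have hθ : ∀ j : ℕ, 1 ≤ j → ((e - j : ℤ) : WithTop ℤ) ≤ v (coeff j (θ y)) := fun j hj => by
    have := h.le_map_coeff hc.ge j
    rwa [map_sub, h.apply_algebraMap, map_sub, coeff_C, if_neg (by omega), sub_zero] at this
  have her : e ≤ r := by
    have := hθ 1 le_rfl
    rw [← derivation_apply h, hr, WithTop.coe_le_coe] at this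
    push_cast at this
    omega
  -- For α = r - e + 1 and ρ = r - 1 the conditions on y and f become 2(r - e) ≤ j(r - e) for j ≥ 2
  -- and r - e ≤ j(r - e) for j ≥ 1; both follow from e ≤ r.
  have := h.le_map_coeff_of_bounds hφ hφk (y := y) (w := w) (α := r - e + 1) (ρ := r - 1)
    (G := m + r - e) (f := f) hr
    (fun n hn => v.coe_le_of_le (by linarith) (hη n hn))
    (fun j hj => v.coe_le_of_le
      (by nlinarith [mul_le_mul_of_nonneg_right (Nat.cast_le (α := ℤ).2 hj) (sub_nonneg.2 her)])
      (hθ j (by omega)))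
    (fun j hj => v.coe_le_of_le
      (by nlinarith [mul_le_mul_of_nonneg_right (Nat.cast_le (α := ℤ).2 hj) (sub_nonneg.2 her)])
      (h.le_map_coeff hf j)) hn
  exact v.coe_le_of_le (by linarith) this

end Estimate

end IsTaylorExpansion

end TaylorExpansion

/-! ### Étale coordinates on local rings -/

section EtaleCoordinate

open PowerSeries IsLocalRing

variable {k O : Type*} [Field k] [CommRing O] [Algebra k O] [Algebra (Polynomial k) O]
  [IsScalarTower k (Polynomial k) O]

theorem algebraMap_polynomial_C (c : k) :
    algebraMap (Polynomial k) O (Polynomial.C c) = algebraMap k O c :=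
  (IsScalarTower.algebraMap_apply k (Polynomial k) O c).symm

variable [Algebra.FormallyEtale (Polynomial k) O]

variable (k O) in
theorem exists_taylor_of_formallyEtale : ∃ θ : O →+* PowerSeries O,
    (∀ f, constantCoeff (θ f) = f) ∧ (∀ c : k, θ (algebraMap k O c) = C (algebraMap k O c)) ∧
    θ (algebraMap (Polynomial k) O Polynomial.X) =
      C (algebraMap (Polynomial k) O Polynomial.X) + X := by
  let g : Polynomial k →+* PowerSeries O :=
    Polynomial.eval₂RingHom ((C (R := O)).comp (algebraMap k O))
      (C (algebraMap (Polynomial k) O Polynomial.X) + X)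
  obtain ⟨θ, ⟨h1, h2⟩, -⟩ := existsUnique_lift_of_formallyEtale g (RingHom.id O) <| by
    refine Polynomial.ringHom_ext (fun c => ?_) ?_
    · simp [g, algebraMap_polynomial_C]
    · simp [g]
  refine ⟨θ, fun f => congr($h2 f), fun c => ?_, ?_⟩
  · rw [← algebraMap_polynomial_C]
    exact congr($h1 (Polynomial.C c)).trans (by simp [g, algebraMap_polynomial_C])
  · exact congr($h1 Polynomial.X).trans (by simp [g])

/-- Its Taylor expansion has linear coefficient 1. -/
theorem coordinate_sub_ne_zero_of_formallyEtale [Nontrivial O] (c : k) :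
    algebraMap (Polynomial k) O Polynomial.X - algebraMap k O c ≠ 0 := by
  obtain ⟨θ, -, h2, h3⟩ := exists_taylor_of_formallyEtale k O
  intro h
  have := congr(coeff 1 (θ $h))
  simp [h2, h3] at this

/-- An étale coordinate generates the maximal ideal at a rational point. -/
theorem maximalIdeal_eq_span_of_formallyEtale [IsLocalRing O] [IsNoetherianRing O]
    (hres : ∀ a : O, ∃ c : k, a - algebraMap k O c ∈ maximalIdeal O) {c : k}
    (hc : algebraMap (Polynomial k) O Polynomial.X - algebraMap k O c ∈ maximalIdeal O) :
    maximalIdeal O =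
      Ideal.span {algebraMap (Polynomial k) O Polynomial.X - algebraMap k O c} := by
  set t := algebraMap (Polynomial k) O Polynomial.X - algebraMap k O c
  have hspan : Ideal.span {t} ≤ maximalIdeal O := (Ideal.span_singleton_le_iff_mem _).2 hc
  have hbij : Function.Bijective (algebraMap k (ResidueField O)) := by
    refine ⟨(algebraMap k (ResidueField O)).injective, fun a => ?_⟩
    obtain ⟨a, rfl⟩ := residue_surjective a
    obtain ⟨c, hc⟩ := hres a
    refine ⟨c, ?_⟩
    rw [← residue_eq_zero_iff, map_sub, sub_eq_zero] at hc
    exact hc.symm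
  let res : O →+* k := ((RingEquiv.ofBijective _ hbij).symm : ResidueField O →+* k).comp (residue O)
  have hresC : ∀ c : k, res (algebraMap k O c) = c := fun c =>
    (RingEquiv.ofBijective _ hbij).symm_apply_apply c
  have hresm : ∀ a : O, a ∈ maximalIdeal O ↔ res a = 0 := fun a => by
    rw [← residue_eq_zero_iff]
    exact (map_eq_zero_iff (RingEquiv.ofBijective _ hbij).symm (RingEquiv.injective _)).symm
  -- Modulo J = (t) + m², projection and evaluation at the point agree on k[X], and differ only by
  -- elements of the square-zero ideal m/J. Unramifiedness makes them equal, so m ⊆ J, and Nakayama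
  -- gives m = (t).
  let J := Ideal.span {t} ⊔ maximalIdeal O * maximalIdeal O
  let I := (maximalIdeal O).map (Ideal.Quotient.mk J)
  have hI : I ^ 2 = ⊥ := by
    rw [← Ideal.map_pow, pow_two, Ideal.map_eq_bot_iff_le_ker, Ideal.mk_ker]
    exact le_sup_right
  let g₁ : O →ₐ[Polynomial k] O ⧸ J := Ideal.Quotient.mkₐ _ J
  let r : O →+* O ⧸ J := ((Ideal.Quotient.mk J).comp (algebraMap k O)).comp res
  have hr : r.comp (algebraMap (Polynomial k) O) =
      (Ideal.Quotient.mk J).comp (algebraMap (Polynomial k) O) := by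
    refine Polynomial.ringHom_ext (fun a => ?_) ?_
    · simp [r, algebraMap_polynomial_C, hresC]
    · have h1 : res (algebraMap (Polynomial k) O Polynomial.X) = c := by
        have := (hresm t).1 hc
        rwa [map_sub, hresC, sub_eq_zero] at this
      simp only [r, RingHom.comp_apply, h1]
      refine (Ideal.Quotient.eq.2 ?_).symm
      exact Ideal.mem_sup_left (Ideal.mem_span_singleton_self t)
  let g₂ : O →ₐ[Polynomial k] O ⧸ J := { r with commutes' := fun p => congr($hr p) }
  have hg : g₁ = g₂ := by
    refine Algebra.FormallyUnramified.ext I ⟨2, hI⟩ fun a => ?_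
    rw [Ideal.Quotient.eq]
    change Ideal.Quotient.mk J a - Ideal.Quotient.mk J (algebraMap k O (res a)) ∈ I
    rw [← map_sub]
    refine Ideal.mem_map_of_mem _ ((hresm _).2 ?_)
    rw [map_sub, hresC, sub_self]
  refine le_antisymm ?_ hspan
  refine Submodule.le_of_le_smul_of_le_jacobson_bot (I := maximalIdeal O)
    (IsNoetherian.noetherian _) (maximalIdeal_le_jacobson _) fun a ha => ?_
  have h1 : Ideal.Quotient.mk J a = Ideal.Quotient.mk J (algebraMap k O (res a)) := congr($hg a)
  rw [(hresm a).1 ha, map_zero, map_zero, Ideal.Quotient.eq_zero_iff_mem] at h1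
  exact h1

theorem isDiscreteValuationRing_of_formallyEtale [IsLocalRing O] [IsNoetherianRing O] [IsDomain O]
    (hres : ∀ a : O, ∃ c : k, a - algebraMap k O c ∈ maximalIdeal O) :
    IsDiscreteValuationRing O := by
  obtain ⟨c, hc⟩ := hres (algebraMap (Polynomial k) O Polynomial.X)
  have hm := maximalIdeal_eq_span_of_formallyEtale hres hc
  have h0 := coordinate_sub_ne_zero_of_formallyEtale (O := O) c
  have hf : ¬ IsField O := fun hf => by
    rw [isField_iff_maximalIdeal_eq.1 hf] at hc
    exact h0 hc
  have key : (maximalIdeal O).IsPrincipal ↔ IsDiscreteValuationRing O :=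
    (IsDiscreteValuationRing.TFAE O hf).out 4 0
  exact key.1 ⟨⟨_, hm⟩⟩

/-- The Taylor expansion with respect to an étale coordinate centred at a rational point. -/
theorem exists_isTaylorExpansion_of_formallyEtale [IsLocalRing O] [IsNoetherianRing O] [IsDomain O]
    (hres : ∀ a : O, ∃ c : k, a - algebraMap k O c ∈ maximalIdeal O)
    {K : Type*} [Field K] [Algebra O K] [IsFractionRing O K] [Algebra k K] [IsScalarTower k O K]
    (v : AddValuation K (WithTop ℤ)) (hv : ∀ f, 0 ≤ v f ↔ f ∈ (algebraMap O K).range)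
    (hv1 : ∀ t : O, maximalIdeal O = Ideal.span {t} → v (algebraMap O K t) = 1) :
    ∃ (t : K) (θ : K →+* PowerSeries K), IsTaylorExpansion k v t θ := by
  obtain ⟨c, hc⟩ := hres (algebraMap (Polynomial k) O Polynomial.X)
  have hm := maximalIdeal_eq_span_of_formallyEtale hres hc
  set s := algebraMap (Polynomial k) O Polynomial.X with hs
  have ht := hv1 _ hm
  obtain ⟨θ₀, h0, hk, hX⟩ := exists_taylor_of_formallyEtale k O
  rw [← hs] at hX
  -- The constant term of θ₀(y) is y, invertible in K, so θ₀ extends to fractions.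
  have hunit : ∀ y : nonZeroDivisors O,
      IsUnit (((PowerSeries.map (algebraMap O K)).comp θ₀) y) := fun y => by
    rw [isUnit_iff_constantCoeff, RingHom.comp_apply, ← coeff_zero_eq_constantCoeff_apply,
      coeff_map, coeff_zero_eq_constantCoeff_apply, h0]
    exact IsLocalization.map_units K y
  let θ : K →+* PowerSeries K := IsLocalization.lift hunit
  have hθ : ∀ a : O, θ (algebraMap O K a) = PowerSeries.map (algebraMap O K) (θ₀ a) :=
    fun a => IsLocalization.lift_eq hunit a
  have hθk : ∀ c : k, θ (algebraMap k K c) = C (algebraMap k K c) := fun c => by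
    rw [IsScalarTower.algebraMap_apply k O K, hθ, hk, map_C]
  have hθs : θ (algebraMap O K s) = C (algebraMap O K s) + X := by
    rw [hθ, hX, map_add, map_C, map_X]
  have hθ0 : (constantCoeff (R := K)).comp θ = RingHom.id K := by
    refine IsLocalization.ringHom_ext (nonZeroDivisors O) ?_
    ext a
    simp only [RingHom.comp_apply, hθ]
    rw [← coeff_zero_eq_constantCoeff_apply, coeff_map, coeff_zero_eq_constantCoeff_apply, h0]
    rfl
  refine ⟨algebraMap O K (s - algebraMap k O c), θ, ?_, ht, ?_, fun f => congr($hθ0 f), hθk, ?_,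
    ?_, ?_⟩
  · intro f hf
    obtain ⟨a, rfl⟩ := (hv f).1 hf
    obtain ⟨d, hd⟩ := hres a
    refine ⟨d, ?_⟩
    rw [IsScalarTower.algebraMap_apply k O K, ← map_sub]
    rw [hm, Ideal.mem_span_singleton] at hd
    obtain ⟨b, hb⟩ := hd
    rw [hb, map_mul]
    refine lt_of_lt_of_le (b := ((1 : ℤ) : WithTop ℤ)) (by exact_mod_cast one_pos) ?_
    exact v.coe_le_map_mul (a := 1) (b := 0) ht.ge ((hv _).2 ⟨b, rfl⟩) (by omega)
  · have hnn : ∀ c : k, 0 ≤ v (algebraMap k K c) := fun c =>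
      (hv _).2 ⟨algebraMap k O c, (IsScalarTower.algebraMap_apply k O K c).symm⟩
    intro c hc
    refine le_antisymm ?_ (hnn c)
    calc v (algebraMap k K c) = v (algebraMap k K c) + 0 := (add_zero _).symm
      _ ≤ v (algebraMap k K c) + v (algebraMap k K c⁻¹) := by
        gcongr
        exact hnn _
      _ = 0 := by rw [← v.map_mul, ← map_mul, mul_inv_cancel₀ hc, map_one, v.map_one]
  · rw [map_sub, map_sub, hθs, ← IsScalarTower.algebraMap_apply k O K, hθk, map_sub]
    ring
  · intro f hf n
    obtain ⟨a, rfl⟩ := (hv f).1 hf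
    rw [hθ, coeff_map]
    exact (hv _).2 ⟨_, rfl⟩
  · intro φ hφ hφk
    set τ := φ (algebraMap O K (s - algebraMap k O c)) - C (algebraMap O K (s - algebraMap k O c))
      with hτdef
    have hτ : HasSubst τ := HasSubst.of_constantCoeff_zero' (by simp [hτdef, hφ])
    let ψ : K →+* PowerSeries K := (substAlgHom (R := K) hτ : _ →+* _).comp θ
    have hψ : ∀ f, ψ f = (θ f).subst τ := fun f => congr_fun (coe_substAlgHom hτ) (θ f)
    have hψk : ∀ c : k, ψ (algebraMap k K c) = C (algebraMap k K c) := fun c => by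
      rw [hψ, hθk, subst_C]; rfl
    -- Both homomorphisms lift O → K and agree on k[X], hence coincide on O by étaleness.
    have hφψ : φ.comp (algebraMap O K) = ψ.comp (algebraMap O K) := by
      refine (existsUnique_lift_of_formallyEtale (R := Polynomial k)
        ((φ.comp (algebraMap O K)).comp (algebraMap (Polynomial k) O)) (algebraMap O K) ?_).unique
        ⟨rfl, ?_⟩ ⟨?_, ?_⟩
      · exact RingHom.ext fun p => hφ _
      · exact RingHom.ext fun a => hφ _
      · refine Polynomial.ringHom_ext (fun a => ?_) ?_
        · simp only [RingHom.comp_apply, algebraMap_polynomial_C,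
            ← IsScalarTower.algebraMap_apply k O K, hψk, hφk]
        · simp only [RingHom.comp_apply, ← hs]
          rw [hψ, hθs, subst_add hτ, subst_C, subst_X hτ, hτdef, map_sub, map_sub,
            ← IsScalarTower.algebraMap_apply k O K, hφk, map_sub]
          change C _ + _ = _
          ring
      · refine RingHom.ext fun a => ?_
        simp only [RingHom.comp_apply, hψ]
        rw [← coeff_zero_eq_constantCoeff_apply,
          AddValuation.coeff_subst_eq_sum (by simp [hτdef, hφ])]
        simpa using congr($hθ0 (algebraMap O K a))
    intro f
    rw [← hψ]
    exact congr($(IsLocalization.ringHom_ext (nonZeroDivisors O) hφψ) f)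

end EtaleCoordinate

/-! ### Local rings and orders of vanishing on the curve -/

namespace SmoothProperCurve

open PowerSeries

variable {k : Type u} [Field k] (C : SmoothProperCurve k) (ξ : C.Point)

/-- The constants in the local ring at a point. -/
noncomputable def stalkConst : k →+* C.X.presheaf.stalk ξ.1 :=
  ((Scheme.ΓSpecIso (.of k)).inv ≫ C.hom.appTop ≫ C.X.presheaf.germ ⊤ ξ.1 trivial).hom

theorem algebraMap_stalkConst (c : k) :
    algebraMap (C.X.presheaf.stalk ξ.1) C.FunctionField (C.stalkConst ξ c) =
      algebraMap k C.FunctionField c := by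
  have h : C.X.presheaf.germ ⊤ ξ.1 trivial ≫ C.X.presheaf.stalkSpecializes
      ((genericPoint_spec C.X).specializes trivial) =
      C.X.presheaf.germ ⊤ (genericPoint C.X) trivial :=
    C.X.presheaf.germ_stalkSpecializes _ _
  exact congr(($h).hom (C.hom.appTop.hom ((Scheme.ΓSpecIso (.of k)).inv.hom c)))

/-- The local rings of a smooth curve are étale over polynomial rings in one variable. -/
theorem exists_formallyEtale_polynomial : ∃ g : Polynomial k →+* C.X.presheaf.stalk ξ.1,
    g.comp Polynomial.C = C.stalkConst ξ ∧ g.FormallyEtale := by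
  obtain ⟨U, hU, V, hV, hx, e, hf⟩ :=
    C.smooth.exists_isStandardSmoothOfRelativeDimension ξ.1
  -- Spec k is a single point.
  have hUtop : U = ⊤ := by
    have : Subsingleton (Spec (.of k)) := inferInstanceAs (Subsingleton (PrimeSpectrum k))
    ext y
    simpa [Subsingleton.elim y (C.hom ξ.1)] using e hx
  subst hUtop
  obtain ⟨g, hg, hge⟩ := hf.exists_etale_mvPolynomial
  let ε : k ≃+* Γ(Spec (.of k), ⊤) := (Scheme.ΓSpecIso (.of k)).symm.commRingCatIsoToRingEquiv
  let j : Polynomial k ≃+* MvPolynomial (Fin 1) Γ(Spec (.of k), ⊤) :=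
    (MvPolynomial.uniqueAlgEquiv k (Fin 1)).symm.toRingEquiv.trans (MvPolynomial.mapEquiv _ ε)
  let germ : Γ(C.X, V) →+* C.X.presheaf.stalk ξ.1 := (C.X.presheaf.germ V ξ.1 hx).hom
  refine ⟨germ.comp (g.comp j), ?_, ?_⟩
  · ext c
    have h1 : g (MvPolynomial.C (ε c)) = (C.hom.appLE ⊤ V e).hom (ε c) := congr($hg (ε c))
    have h2 : j (Polynomial.C c) = MvPolynomial.C (ε c) := by
      simp [j]
    have h3 : C.hom.appLE ⊤ V e ≫ C.X.presheaf.germ V ξ.1 hx =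
        C.hom.appTop ≫ C.X.presheaf.germ ⊤ ξ.1 trivial := by
      rw [Scheme.Hom.appLE, Category.assoc, TopCat.Presheaf.germ_res]
      rfl
    simp only [RingHom.comp_apply, RingHom.coe_coe, h2, h1]
    exact congr(($h3).hom (ε c))
  · refine RingHom.FormallyEtale.comp (RingHom.FormallyEtale.comp ?_ ?_) ?_
    · let _ := (j : Polynomial k →+* MvPolynomial (Fin 1) Γ(Spec (.of k), ⊤)).toAlgebra
      exact Algebra.FormallyEtale.of_equiv (R := Polynomial k)
        (AlgEquiv.ofRingEquiv (f := j) fun _ => rfl)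
    · let _ := g.toAlgebra
      exact (show Algebra.Etale _ _ from hge).formallyEtale
    · have := hV.isLocalization_stalk ⟨ξ.1, hx⟩
      let _ := TopCat.Presheaf.algebra_section_stalk C.X.presheaf (⟨ξ.1, hx⟩ : V)
      exact Algebra.FormallyEtale.of_isLocalization (Rₘ := C.X.presheaf.stalk ξ.1)
        (hV.primeIdealOf ⟨ξ.1, hx⟩).asIdeal.primeCompl

variable [IsAlgClosed k]

/-- Over an algebraically closed field the residue field at a closed point is k; the work is to
match this isomorphism with the inclusion of constants. -/
theorem exists_sub_stalkConst_mem (a : C.X.presheaf.stalk ξ.1) :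
    ∃ c : k, a - C.stalkConst ξ c ∈ IsLocalRing.maximalIdeal (C.X.presheaf.stalk ξ.1) := by
  let i := residueFieldIsoBase C.hom ξ.1 ξ.2
  have h0 : Spec.map (CommRingCat.ofHom (C.stalkConst ξ)) = C.X.fromSpecStalk ξ.1 ≫ C.hom := by
    refine ext_of_isAffine ?_
    rw [Scheme.Hom.comp_appTop, Scheme.fromSpecStalk_appTop]
    have := Scheme.ΓSpecIso_naturality (CommRingCat.ofHom (C.stalkConst ξ))
    rw [← Iso.eq_comp_inv] at this
    rw [this]
    simp [stalkConst]
  have h2 : i.inv = CommRingCat.ofHom (C.stalkConst ξ) ≫ C.X.residue ξ.1 := by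
    refine Spec.map_injective ?_
    rw [SpecMap_residueFieldIsoBase_inv, Spec.map_comp, h0, Scheme.fromSpecResidueField,
      Category.assoc]
  refine ⟨i.hom.hom (C.X.residue ξ.1 a), ?_⟩
  rw [← IsLocalRing.residue_eq_zero_iff, map_sub, sub_eq_zero]
  have h3 := congr(($h2).hom (i.hom.hom (C.X.residue ξ.1 a)))
  refine Eq.trans ?_ h3
  simp
  rfl

end SmoothProperCurve

namespace SmoothProperCurve

open PowerSeries

variable {k : Type u} [Field k] (C : SmoothProperCurve k) (ξ : C.Point)

noncomputable instance stalkAlgebra : Algebra k (C.X.presheaf.stalk ξ.1) :=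
  (C.stalkConst ξ).toAlgebra

instance : IsScalarTower k (C.X.presheaf.stalk ξ.1) C.FunctionField :=
  IsScalarTower.of_algebraMap_eq fun c => (C.algebraMap_stalkConst ξ c).symm

theorem val_of_ne_zero {f : C.FunctionField} (hf : f ≠ 0) :
    C.val ξ f = ((Scheme.ord f ξ.1 : ℤ) : WithTop ℤ) := if_neg hf

variable [IsAlgClosed k]

instance : IsDiscreteValuationRing (C.X.presheaf.stalk ξ.1) := by
  obtain ⟨g, hg, hge⟩ := C.exists_formallyEtale_polynomial ξ
  let _ := g.toAlgebra
  have : IsScalarTower k (Polynomial k) (C.X.presheaf.stalk ξ.1) :=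
    IsScalarTower.of_algebraMap_eq fun c => congr($hg c).symm
  have : Algebra.FormallyEtale (Polynomial k) (C.X.presheaf.stalk ξ.1) := hge
  exact isDiscreteValuationRing_of_formallyEtale (C.exists_sub_stalkConst_mem ξ)

theorem coheight_eq_one : Order.coheight ξ.1 = 1 := by
  have h := ringKrullDim_stalk_eq_coheight ξ.1
  rw [IsDiscreteValuationRing.ringKrullDim_eq_one] at h
  exact_mod_cast h.symm

/-- The order of vanishing at a point as an additive valuation. -/
noncomputable def addVal : AddValuation C.FunctionField (WithTop ℤ) :=
  AddValuation.of (C.val ξ) (if_pos rfl)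
    (by
      rw [C.val_of_ne_zero ξ one_ne_zero]
      have := Scheme.ord_mul (x := ξ.1) (one_ne_zero (α := C.FunctionField)) one_ne_zero
      rw [mul_one] at this
      exact_mod_cast (by omega : Scheme.ord (1 : C.FunctionField) ξ.1 = 0))
    (fun f g => by
      by_cases hfg : f + g = 0
      · simp [val, hfg]
      by_cases hf : f = 0
      · simp [hf]
      by_cases hg : g = 0
      · simp [hg]
      rw [C.val_of_ne_zero ξ hf, C.val_of_ne_zero ξ hg, C.val_of_ne_zero ξ hfg]
      exact_mod_cast Scheme.ord_add hfg)
    (fun f g => by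
      by_cases hf : f = 0
      · simp [val, hf]
      by_cases hg : g = 0
      · simp [val, hg]
      rw [C.val_of_ne_zero ξ hf, C.val_of_ne_zero ξ hg, C.val_of_ne_zero ξ (mul_ne_zero hf hg),
        Scheme.ord_mul hf hg, WithTop.coe_add])

theorem addVal_apply (f : C.FunctionField) : C.addVal ξ f = C.val ξ f := rfl

theorem zero_le_val_iff (f : C.FunctionField) : 0 ≤ C.val ξ f ↔ C.RegularAt f ξ := by
  by_cases hf : f = 0
  · simp [val, hf, RegularAt]
  rw [C.val_of_ne_zero ξ hf, ← WithTop.coe_zero, WithTop.coe_le_coe,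
    Scheme.le_ord_iff (C.coheight_eq_one ξ) hf]
  change (1 : WithZero (Multiplicative ℤ)) ≤
    Ring.ordFrac (C.X.presheaf.stalk ξ.1) f ↔ _
  rw [Ring.ordFrac_eq_valuation_inv, one_le_inv₀ (by simpa [zero_lt_iff] using hf)]
  constructor
  · intro h
    exact IsDiscreteValuationRing.exists_lift_of_le_one h
  · rintro ⟨a, rfl⟩
    exact IsDedekindDomain.HeightOneSpectrum.valuation_le_one _ a

theorem val_eq_one_of_maximalIdeal_eq_span {t : C.X.presheaf.stalk ξ.1}
    (ht : IsLocalRing.maximalIdeal (C.X.presheaf.stalk ξ.1) = Ideal.span {t}) :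
    C.val ξ (algebraMap _ C.FunctionField t) = 1 := by
  have hirr := (IsDiscreteValuationRing.irreducible_iff_uniformizer t).2 ht
  have h0 : algebraMap _ C.FunctionField t ≠ 0 := by
    simpa using hirr.ne_zero
  rw [C.val_of_ne_zero ξ h0]
  have : Scheme.ord (algebraMap _ C.FunctionField t) ξ.1 = 1 := by
    rw [Scheme.ord_eq_iff (C.coheight_eq_one ξ) h0]
    exact Ring.ordFrac_irreducible hirr
  rw [this]
  rfl

theorem exists_isTaylorExpansion : ∃ (t : C.FunctionField)
    (θ : C.FunctionField →+* PowerSeries C.FunctionField),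
    IsTaylorExpansion k (C.addVal ξ) t θ := by
  obtain ⟨g, hg, hge⟩ := C.exists_formallyEtale_polynomial ξ
  let _ := g.toAlgebra
  have : IsScalarTower k (Polynomial k) (C.X.presheaf.stalk ξ.1) :=
    IsScalarTower.of_algebraMap_eq fun c => congr($hg c).symm
  have : Algebra.FormallyEtale (Polynomial k) (C.X.presheaf.stalk ξ.1) := hge
  exact exists_isTaylorExpansion_of_formallyEtale (C.exists_sub_stalkConst_mem ξ) (C.addVal ξ)
    (C.zero_le_val_iff ξ) fun t ht => C.val_eq_one_of_maximalIdeal_eq_span ξ ht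

end SmoothProperCurve

/-! ### Ramification data in terms of dy/dt -/

namespace SmoothProperCurve

open PowerSeries

variable {k : Type u} [Field k] [IsAlgClosed k] (C : SmoothProperCurve k) {ξ inf : C.Point}
  {x t : C.FunctionField} {θ : C.FunctionField →+* PowerSeries C.FunctionField}

theorem val_sub_value_pos {y : C.FunctionField} (hy : 0 ≤ C.val ξ y) :
    0 < C.val ξ (y - algebraMap k C.FunctionField (C.value ξ y)) := by
  obtain ⟨t, θ, h⟩ := C.exists_isTaylorExpansion ξ
  exact Classical.epsilon_spec (h.exists_residue y hy)

theorem isExpansion_expansion {s y : C.FunctionField} (hs : C.val ξ s = 1) (hy : 0 ≤ C.val ξ y) :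
    C.IsExpansion ξ s y (C.expansion ξ s y) := by
  obtain ⟨t, θ, h⟩ := C.exists_isTaylorExpansion ξ
  exact Classical.epsilon_spec (h.exists_expansion hs hy)

/-- An algebraic x would be a constant, and constants have no poles. -/
theorem transcendental_of_val_neg (hx : C.val ξ x < 0) : Transcendental k x := by
  intro halg
  obtain ⟨t, θ, h⟩ := C.exists_isTaylorExpansion ξ
  obtain ⟨c, rfl⟩ := minpoly.mem_range_of_degree_eq_one k x
    (IsAlgClosed.degree_eq_one_of_irreducible k (minpoly.irreducible halg.isIntegral))
  exact absurd (h.map_algebraMap_nonneg c) (not_le.2 hx)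

section Local

variable (h : IsTaylorExpansion k (C.addVal ξ) t θ)
include h

/-- If dx/dt = 0, separability forces d/dt = 0, against dt/dt = 1. -/
theorem derivation_coord_ne_zero (hx : x ≠ 0)
    (hsep : Algebra.IsSeparable k⟮x⟯ C.FunctionField) : h.derivation (C.coord inf x ξ) ≠ 0 := by
  have hD : h.derivation x ≠ 0 := fun h0 => by
    have := Derivation.eq_zero_of_apply_eq_zero_of_isSeparable hsep h.derivation h0
    have h1 := h.derivation_uniformizer
    rw [this] at h1
    exact zero_ne_one h1
  rw [coord]
  split_ifs
  · rw [Derivation.leibniz_inv]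
    exact smul_ne_zero (neg_ne_zero.2 (pow_ne_zero _ (inv_ne_zero hx))) hD
  · exact hD

theorem val_derivation_coord {s : C.FunctionField} (hs : C.val ξ s = 1)
    (hy : 0 ≤ C.val ξ (C.coord inf x ξ)) (hD : h.derivation (C.coord inf x ξ) ≠ 0) :
    C.addVal ξ (h.derivation (C.coord inf x ξ)) = (((C.ramR inf x ξ s : ℕ) : ℤ) - 1 : ℤ) :=
  h.map_derivation_eq_of_expansion hs (C.isExpansion_expansion hs hy) hD

theorem val_coord_sub_value (hD : h.derivation (C.coord inf x ξ) ≠ 0) :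
    C.val ξ (C.coord inf x ξ - algebraMap k C.FunctionField (C.value ξ (C.coord inf x ξ))) =
      (C.ramDegree inf x ξ : WithTop ℤ) := by
  refine C.val_of_ne_zero ξ fun h0 => hD ?_
  rw [sub_eq_zero.1 h0, Derivation.map_algebraMap]

/-- Here e = 1, so the coordinate minus its value is a uniformizer. -/
theorem val_derivation_coord_of_notMem_ramSet (hξ : ξ ∉ C.ramSet inf x)
    (hy : 0 ≤ C.val ξ (C.coord inf x ξ)) (hD : h.derivation (C.coord inf x ξ) ≠ 0) :
    C.addVal ξ (h.derivation (C.coord inf x ξ)) = 0 := by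
  have h1 := C.val_coord_sub_value h hD
  have h2 := C.val_sub_value_pos hy
  rw [h1] at h2
  have h3 : 0 < C.ramDegree inf x ξ := by exact_mod_cast h2
  have h4 : C.ramDegree inf x ξ < 2 := not_le.1 hξ
  rw [show C.ramDegree inf x ξ = 1 by omega] at h1
  have := h.map_derivation_of_uniformizer h1
  rwa [map_sub, Derivation.map_algebraMap, sub_zero] at this

end Local

variable {D : HasseSchmidtDerivation k C.FunctionField}

theorem val_coe_inv_pole {d : ℕ} (hx : x ≠ 0) (hpole : C.val inf x = ((-(d : ℤ) : ℤ) : WithTop ℤ)) :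
    C.val inf x⁻¹ = ((d : ℤ) : WithTop ℤ) := by
  have h1 : C.addVal inf (x⁻¹ * x) = 0 := by rw [inv_mul_cancel₀ hx, AddValuation.map_one]
  rw [AddValuation.map_mul, addVal_apply, addVal_apply, hpole] at h1
  induction hg : C.val inf x⁻¹ using WithTop.recTopCoe with
  | top =>
    rw [hg, top_add] at h1
    exact absurd h1 WithTop.top_ne_zero
  | coe m =>
    rw [hg, ← WithTop.coe_add, ← WithTop.coe_zero, WithTop.coe_inj] at h1
    rw [WithTop.coe_inj]
    omega

/-- `D_n(1 / x) = ± x ^ (-n - 1)` vanishes to order at least `(n + 1) d` at the pole of `x`. -/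
theorem le_val_apply_inv (hD : D.ExtendsStandard x) {d : ℕ}
    (hd : C.val inf x⁻¹ = ((d : ℤ) : WithTop ℤ)) (n : ℕ) :
    (((n + 1) * d : ℤ) : WithTop ℤ) ≤ C.val inf (D.D n x⁻¹) := by
  have h1 := hD (-1) n
  rw [zpow_neg_one] at h1
  rw [h1, ← addVal_apply]
  refine (C.addVal inf).coe_le_map_mul (a := 0) (b := (n + 1) * d)
    ((C.addVal inf).zero_le_map_intCast _) (le_of_eq ?_) (by omega)
  rw [show (-1 - (n : ℤ)) = -((n + 1 : ℕ) : ℤ) by push_cast; ring, zpow_neg, zpow_natCast, ← inv_pow,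
    AddValuation.map_pow, addVal_apply, hd, ← WithTop.coe_nsmul, nsmul_eq_mul]
  push_cast
  rfl

end SmoothProperCurve

/-! ### The estimates at unramified points, finite ramified points and ∞ -/

theorem mainTheorem7 {k : Type u} [Field k] [IsAlgClosed k] (C : SmoothProperCurve k)
    (inf : C.Point) (x : C.FunctionField) (d : ℕ) (hd : 0 < d)
    (hfin : ∀ ξ : C.Point, ξ ≠ inf → C.RegularAt x ξ)
    (hpole : C.val inf x = ((-(d : ℤ) : ℤ) : WithTop ℤ))
    (hsep : Algebra.IsSeparable k⟮x⟯ C.FunctionField) :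
    (∃! D : HasseSchmidtDerivation k C.FunctionField, D.ExtendsStandard x) ∧
    ∀ D : HasseSchmidtDerivation k C.FunctionField, D.ExtendsStandard x →
      ∀ f : C.FunctionField, C.RegularOn f (C.ramSet inf x)ᶜ →
        ∀ n : ℕ, 1 ≤ n →
          C.RegularOn (D.D n f) (C.ramSet inf x)ᶜ ∧
          (∀ ξ ∈ C.ramSet inf x, ξ ≠ inf → ∀ t : C.FunctionField, C.val ξ t = 1 →
            ((((n : ℤ) - 1) * C.ramDegree inf x ξ
                - (2 * (n : ℤ) - 1) * (C.ramR inf x ξ t : ℤ) : ℤ) : WithTop ℤ) + C.val ξ f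
              ≤ C.val ξ (D.D n f)) ∧
          (∀ t : C.FunctionField, C.val inf t = 1 →
            (((3 * (n : ℤ) - 1) * (d : ℤ)
                - (2 * (n : ℤ) - 1) * (C.ramR inf x inf t : ℤ) : ℤ) : WithTop ℤ) + C.val inf f
              ≤ C.val inf (D.D n f)) := by
  have hx0 : x ≠ 0 := by
    rintro rfl
    rw [show C.val inf 0 = ⊤ from if_pos rfl] at hpole
    exact WithTop.coe_ne_top hpole.symm
  have hinv := C.val_coe_inv_pole hx0 hpole
  have hreg : ∀ ξ, 0 ≤ C.val ξ (C.coord inf x ξ) := fun ξ => by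
    rw [SmoothProperCurve.coord]
    split_ifs with hξ
    · rw [hξ, hinv]
      exact_mod_cast d.cast_nonneg
    · exact (C.zero_le_val_iff ξ x).2 (hfin ξ hξ)
  refine ⟨HasseSchmidtDerivation.existsUnique_extendsStandard (C.transcendental_of_val_neg
    (ξ := inf) ?_) hsep, fun D hD f hf n hn => ⟨fun ξ hξ => ?_, fun ξ _ hne s hs => ?_,
    fun s hs => ?_⟩⟩
  · rw [hpole]
    exact_mod_cast (by omega : -(d : ℤ) < 0)
  · obtain ⟨t, θ, h⟩ := C.exists_isTaylorExpansion ξ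
    have hder := C.derivation_coord_ne_zero (inf := inf) h hx0 hsep
    rw [← C.zero_le_val_iff, ← C.addVal_apply, ← D.coeff_toSeries]
    refine h.map_coeff_nonneg_of_unramified D.constantCoeff_toSeries D.toSeries_algebraMap (hreg ξ)
      (C.val_derivation_coord_of_notMem_ramSet h hξ (hreg ξ) hder) (fun n hn => ?_)
      ((C.zero_le_val_iff ξ f).2 (hf ξ hξ)) hn
    rw [D.coeff_toSeries, SmoothProperCurve.coord]
    split_ifs with hξ
    · rw [hξ]
      refine le_trans ?_ (C.le_val_apply_inv hD hinv n)
      exact_mod_cast Nat.zero_le _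
    · rw [hD.apply_self hn]
      split_ifs <;> simp
  · obtain ⟨t, θ, h⟩ := C.exists_isTaylorExpansion ξ
    have hder := C.derivation_coord_ne_zero (inf := inf) h hx0 hsep
    have hr := C.val_derivation_coord h hs (hreg ξ) hder
    have he := C.val_coord_sub_value h hder
    induction hm : C.val ξ f using WithTop.recTopCoe with
    | top =>
      rw [(C.addVal ξ).top_iff.1 hm, map_zero, ← C.addVal_apply, AddValuation.map_zero]
      exact le_top
    | coe m =>
      -- w = e - 2r makes the required bound 0 at n = 1, where D_1(x) = 1; for n ≥ 2, D_n(x) = 0.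
      have key := h.le_map_coeff_of_ramified D.constantCoeff_toSeries D.toSeries_algebraMap
        (w := C.ramDegree inf x ξ - 2 * C.ramR inf x ξ s) he hr (fun n hn => ?_) hm.ge hn
      · rw [D.coeff_toSeries] at key
        rw [← WithTop.coe_add]
        exact (C.addVal ξ).coe_le_of_le (by linarith) key
      · rw [D.coeff_toSeries, SmoothProperCurve.coord, if_neg hne,
          hD.apply_self hn]
        split_ifs with hn1
        · exact (C.addVal ξ).coe_le_of_le (b := 0) (by rw [hn1]; push_cast; linarith)
            (C.addVal ξ).map_one.ge
        · simp
  · obtain ⟨t, θ, h⟩ := C.exists_isTaylorExpansion inf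
    have hder := C.derivation_coord_ne_zero (inf := inf) h hx0 hsep
    have hr := C.val_derivation_coord h hs (hreg inf) hder
    have hcoord : C.coord inf x inf = x⁻¹ := if_pos rfl
    -- The value of 1/x at ∞ is 0, so d plays the role of e.
    have he : C.addVal inf (C.coord inf x inf - algebraMap k C.FunctionField 0) =
        ((d : ℤ) : WithTop ℤ) := by rw [map_zero, sub_zero, hcoord]; exact hinv
    have hdr : (d : ℤ) ≤ C.ramR inf x inf s := by
      have := h.le_map_derivation he.ge
      rw [map_sub, map_zero, map_zero, sub_zero, hr, WithTop.coe_le_coe] at this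
      omega
    induction hm : C.val inf f using WithTop.recTopCoe with
    | top =>
      rw [(C.addVal inf).top_iff.1 hm, map_zero, ← C.addVal_apply, AddValuation.map_zero]
      exact le_top
    | coe m =>
      -- w = 3d - 2r makes the required bound 2d at n = 1, matching D_1(1/x) = -x^(-2).
      have key := h.le_map_coeff_of_ramified D.constantCoeff_toSeries D.toSeries_algebraMap
        (w := 3 * d - 2 * C.ramR inf x inf s) he hr (fun n hn => ?_) hm.ge hn
      · rw [D.coeff_toSeries] at key
        rw [← WithTop.coe_add]
        exact (C.addVal inf).coe_le_of_le (by linarith) key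
      · rw [D.coeff_toSeries, hcoord]
        refine (C.addVal inf).coe_le_of_le ?_ (C.le_val_apply_inv hD hinv n)
        -- The slack is 2(n - 1)(r - d).
        nlinarith [mul_nonneg (sub_nonneg.2 (Nat.cast_le (α := ℤ).2 hn)) (sub_nonneg.2 hdr)]
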